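/- **Setting.** Let $n\in\mathbb R^d$ be a unit vector (the outward unit normal attached to a non-reflecting boundary node). A state is $u=(\rho,m,E)\in\mathbb R\times\mathbb R^d\times\mathbb R$, with velocity $V=\rho^{-1}m$ and specific internal energy $e(u)=\rho^{-1}E-\frac12\|\rho^{-1}m\|^2$; the set of admissible states is $\mathcal A=\{u:\rho>0,\ e(u)>0\}$. Write $V_n=V\cdot n$, $V^\perp=V-V_n n$. For a pressure law $p$ the Euler flux in direction $n$ is $f(u)n=(m\cdot n,\ V_n m+p(u)n,\ V_n(E+p(u)))$. For the $\gamma$-law, $p(u)=(\gamma-1)\rho e(u)$, put $S=\rho^{-\gamma}p$, $a=\sqrt{\gamma p/\rho}$, $\lambda_1=V_n-a$, $\lambda_2=V_n$, $\lambda_3=V_n+a$, $C_1=V_n-\frac{2a}{\gamma-1}$, $C_3=V_n+\frac{2a}{\gamma-1}$. Let $U\in\mathcal A$ be the state at the node and let $U^D\in\mathcal A$ be the Dirichlet state; quantities of $U^D$ carry the superscript $D$. Consider the Riemann problem $\partial_t v+\partial_x(f(v)n)=0$ with left data $U$ and right data $U^D$, and let $G(n,U,U^D)$ be the value at $x=0$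 of its solution. **Lemma (Non-reflecting condition).** The post-processed state $U^P$ belongs to $\mathcal A$ in each of the following cases. 1. *(Godunov, arbitrary pressure law.)* $U^P=G(n,U,U^D)$, where $p$ is any pressure law, the solution is any bounded self-similar weak solution $v(x,t)=w(x/t)$ of the Riemann problem, with bounded flux, whose values lie almost everywhere in a compact subset of $\mathcal A$, and its value at $x=0$ is the (essential) left or right limit of $w$ at $0$. 2. *(Godunov, $\gamma$-law, any $\gamma>1$.)* $U^P=G(n,U,U^D)$, where the solution $w(x/t)$ is the Lax solution: either a 1-wave (Lax shock or centered rarefaction), a contact discontinuity and a 3-wave separated by constant states of positive density, or, when $C_3(U)\le C_1(U^D)$, a 1-rarefaction and a 3-rarefaction separated by the vacuum sector $C_3(U)\le x/t\le C_1(U^D)$. Such a solution exists for all $U,U^D\in\mathcal A$; and $w(0)\in\mathcal A$ for each such solution provided that $x=0$ is not in the vacuum sector, i.e. unless $C_3(U)\le 0\le C_1(U^D)$. (If a discontinuity sits at $x=0$, $w(0)$ is either of its two one-sided states.) 3. *(Characteristic variables, $\gamma$-law with $\gamma\in(1,3]$.)* Assume $\frac{\gamma-1}{2}V_n^D\le a^D$,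 and that one does not have simultaneously $\gamma=3$, $V_n=-a$ and $V_n^D=a^D$. Here $U^P$ is given by * supersonic inflow, $\lambda_3(U)<0$: $U^P=U^D$; * subsonic inflow, $\lambda_2(U)<0\le\lambda_3(U)$: $U^P=(\rho^P,m^P,E^P)$ as below with $S^*=S(U^D)$, $W=(V^D)^\perp$; * subsonic outflow, $\lambda_1(U)<0\le\lambda_2(U)$: $U^P=(\rho^P,m^P,E^P)$ as below with $S^*=S(U)$, $W=V^\perp$; * supersonic outflow, $0\le\lambda_1(U)$: $U^P=U$; where $$\rho^P=\Big(\tfrac1{\gamma S^*}\big(\tfrac{\gamma-1}4(C_3(U)-C_1(U^D))\big)^2\Big)^{\frac1{\gamma-1}},\quad m^P=\rho^P\big(W+\tfrac12(C_1(U^D)+C_3(U))\,n\big),\quad E^P=\frac{S^*(\rho^P)^\gamma}{\gamma-1}+\frac{\|m^P\|^2}{2\rho^P}.$$ -/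

import Mathlib

open MeasureTheory Filter Topology

noncomputable section

namespace CompressibleEuler

/-- Conserved variables `(ρ, m, E)`: density, momentum, total energy. -/
abbrev State (d : ℕ) : Type := ℝ × EuclideanSpace ℝ (Fin d) × ℝ

variable {d : ℕ}

def density (u : State d) : ℝ := u.1

def momentum (u : State d) : EuclideanSpace ℝ (Fin d) := u.2.1

def totalEnergy (u : State d) : ℝ := u.2.2

def velocity (u : State d) : EuclideanSpace ℝ (Fin d) := (density u)⁻¹ • momentum u

/-- Specific internal energy `e(u) = E / ρ - ‖m / ρ‖² / 2`. -/
def internalEnergy (u : State d) : ℝ :=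
  (density u)⁻¹ * totalEnergy u - 1 / 2 * ‖(density u)⁻¹ • momentum u‖ ^ 2

/-- The set `𝒜` of admissible states. -/
def admissible (d : ℕ) : Set (State d) :=
  {u | 0 < density u ∧ 0 < internalEnergy u}

/-- `V_n = V ⬝ n`. -/
def normalVelocity (n : EuclideanSpace ℝ (Fin d)) (u : State d) : ℝ :=
  inner ℝ (velocity u) n

/-- `V^⊥ = V - (V ⬝ n) n`. -/
def tangentialVelocity (n : EuclideanSpace ℝ (Fin d)) (u : State d) :
    EuclideanSpace ℝ (Fin d) :=
  velocity u - normalVelocity n u • n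

/-- The Euler flux in direction `n`, for a pressure law `p`:
`f(u) n = (m ⬝ n, (V ⬝ n) m + p n, (V ⬝ n) (E + p))`. -/
def normalFlux (p : State d → ℝ) (n : EuclideanSpace ℝ (Fin d)) (u : State d) : State d :=
  (inner ℝ (momentum u) n,
    normalVelocity n u • momentum u + p u • n,
    normalVelocity n u * (totalEnergy u + p u))

/-! ### Riemann problem for an arbitrary pressure law -/

/-- The initial data of the Riemann problem. -/
def riemannData (UL UR : State d) (x : ℝ) : State d := if x < 0 then UL else UR

/-- `(x, t) ↦ w (x / t)` is a self-similar bounded weak solution of the Riemann problem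
`∂ₜ v + ∂ₓ (f(v) n) = 0`, `v(x, 0) = UL` for `x < 0`, `v(x, 0) = UR` for `x > 0`.
Points of the space-time plane are `z = (x, t)`.  As the pressure is only meaningful on `𝒜`,
the solution takes its values, almost everywhere, in a compact subset of `𝒜`
(bounded, and away from vacuum).  No entropy condition is imposed, so all weak solutions are
covered. -/
structure IsWeakRiemannSolution (p : State d → ℝ) (n : EuclideanSpace ℝ (Fin d))
    (UL UR : State d) (w : ℝ → State d) : Prop where
  measurable : AEStronglyMeasurable w volume
  range_subset : ∃ K : Set (State d), IsCompact K ∧ K ⊆ admissible d ∧ ∀ᵐ ξ : ℝ, w ξ ∈ K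
  flux_bounded : MemLp (fun ξ : ℝ => normalFlux p n (w ξ)) ⊤ volume
  weak_form : ∀ φ : ℝ × ℝ → ℝ, ContDiff ℝ (⊤ : ℕ∞) φ → HasCompactSupport φ →
    (∫ z in {z : ℝ × ℝ | 0 < z.2},
        (fderiv ℝ φ z (0, 1) • w (z.1 / z.2) +
          fderiv ℝ φ z (1, 0) • normalFlux p n (w (z.1 / z.2)))) +
      ∫ x : ℝ, φ (x, 0) • riemannData UL UR x = 0

/-- `G` is the value at `x = 0` of `(x, t) ↦ w (x / t)`: the limit at `0` of `w`, defined almost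
everywhere, from the left or from the right (they differ if a discontinuity sits at `x = 0`). -/
def IsInterfaceValue (w : ℝ → State d) (G : State d) : Prop :=
  Tendsto w (ae volume ⊓ 𝓝[<] 0) (𝓝 G) ∨ Tendsto w (ae volume ⊓ 𝓝[>] 0) (𝓝 G)

/-! ### The γ-law and its characteristic variables -/

/-- `p(u) = (γ - 1) ρ e(u)`. -/
def gammaPressure (γ : ℝ) (u : State d) : ℝ := (γ - 1) * density u * internalEnergy u

/-- `S(u) = ρ ^ (-γ) p(u)`. -/
def entropyS (γ : ℝ) (u : State d) : ℝ := density u ^ (-γ) * gammaPressure γ u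

/-- `a = √(γ p / ρ)`. -/
def soundSpeed (γ : ℝ) (u : State d) : ℝ := √(γ * gammaPressure γ u * (density u)⁻¹)

/-- `λ₁ = V_n - a`. -/
def speed1 (γ : ℝ) (n : EuclideanSpace ℝ (Fin d)) (u : State d) : ℝ :=
  normalVelocity n u - soundSpeed γ u

/-- `λ₂ = V_n`. -/
def speed2 (n : EuclideanSpace ℝ (Fin d)) (u : State d) : ℝ := normalVelocity n u

/-- `λ₃ = V_n + a`. -/
def speed3 (γ : ℝ) (n : EuclideanSpace ℝ (Fin d)) (u : State d) : ℝ :=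
  normalVelocity n u + soundSpeed γ u

/-- `C₁ = V_n - 2 a / (γ - 1)`. -/
def charVar1 (γ : ℝ) (n : EuclideanSpace ℝ (Fin d)) (u : State d) : ℝ :=
  normalVelocity n u - 2 * soundSpeed γ u / (γ - 1)

/-- `C₃ = V_n + 2 a / (γ - 1)`. -/
def charVar3 (γ : ℝ) (n : EuclideanSpace ℝ (Fin d)) (u : State d) : ℝ :=
  normalVelocity n u + 2 * soundSpeed γ u / (γ - 1)

/-! ### The exact (Lax) solution of the Riemann problem for the γ-law -/

/-- Rankine–Hugoniot condition for a jump from `u` to `v` moving at speed `s`. -/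
def RankineHugoniot (γ : ℝ) (n : EuclideanSpace ℝ (Fin d)) (u v : State d) (s : ℝ) : Prop :=
  normalFlux (gammaPressure γ) n v - normalFlux (gammaPressure γ) n u = s • (v - u)

/-- `u` is the state at `x / t = ξ` of the centered 1-rarefaction issued from `UL`:
`λ₁ = ξ`, and the 1-Riemann invariants `C₃`, `S`, `V^⊥` are those of `UL`. -/
def OnFan1 (γ : ℝ) (n : EuclideanSpace ℝ (Fin d)) (UL : State d) (ξ : ℝ) (u : State d) : Prop :=
  0 < density u ∧ speed1 γ n u = ξ ∧ charVar3 γ n u = charVar3 γ n UL ∧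
    entropyS γ u = entropyS γ UL ∧ tangentialVelocity n u = tangentialVelocity n UL

/-- `u` is the state at `x / t = ξ` of the centered 3-rarefaction ending at `UR`:
`λ₃ = ξ`, and the 3-Riemann invariants `C₁`, `S`, `V^⊥` are those of `UR`. -/
def OnFan3 (γ : ℝ) (n : EuclideanSpace ℝ (Fin d)) (UR : State d) (ξ : ℝ) (u : State d) : Prop :=
  0 < density u ∧ speed3 γ n u = ξ ∧ charVar1 γ n u = charVar1 γ n UR ∧
    entropyS γ u = entropyS γ UR ∧ tangentialVelocity n u = tangentialVelocity n UR

/-- In the profile `w`, the sector `l ≤ x / t ≤ r` is a 1-wave from `UL` to `UM`: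
a Lax 1-shock (`l = r` is its speed), or a centered rarefaction (no wave at all if `l = r`). -/
def IsWave1 (γ : ℝ) (n : EuclideanSpace ℝ (Fin d)) (w : ℝ → State d) (UL UM : State d)
    (l r : ℝ) : Prop :=
  (l = r ∧ RankineHugoniot γ n UL UM l ∧
      speed1 γ n UM < l ∧ l < speed1 γ n UL ∧ l < speed2 n UM ∧ (w l = UL ∨ w l = UM)) ∨
    (l = speed1 γ n UL ∧ l ≤ r ∧ OnFan1 γ n UL r UM ∧
      ∀ ξ, l ≤ ξ → ξ ≤ r → OnFan1 γ n UL ξ (w ξ))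

/-- In the profile `w`, the sector `l ≤ x / t ≤ r` is a 3-wave from `UM` to `UR`. -/
def IsWave3 (γ : ℝ) (n : EuclideanSpace ℝ (Fin d)) (w : ℝ → State d) (UM UR : State d)
    (l r : ℝ) : Prop :=
  (l = r ∧ RankineHugoniot γ n UM UR l ∧
      speed3 γ n UR < l ∧ l < speed3 γ n UM ∧ speed2 n UM < l ∧ (w l = UM ∨ w l = UR)) ∨
    (r = speed3 γ n UR ∧ l ≤ r ∧ OnFan3 γ n UR l UM ∧
      ∀ ξ, l ≤ ξ → ξ ≤ r → OnFan3 γ n UR ξ (w ξ))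

/-- Solution without vacuum: a 1-wave, a contact discontinuity moving at speed `s` (across which
`V_n` and `p` are continuous) and a 3-wave, separated by constant states.  The intermediate states
are only asked to have positive density. -/
def IsThreeWaveSolution (γ : ℝ) (n : EuclideanSpace ℝ (Fin d)) (UL UR : State d)
    (w : ℝ → State d) : Prop :=
  ∃ (ML MR : State d) (l₁ r₁ s l₃ r₃ : ℝ),
    0 < density ML ∧ 0 < density MR ∧
    IsWave1 γ n w UL ML l₁ r₁ ∧
    normalVelocity n ML = s ∧ normalVelocity n MR = s ∧
    gammaPressure γ ML = gammaPressure γ MR ∧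
    IsWave3 γ n w MR UR l₃ r₃ ∧
    (∀ ξ, ξ < l₁ → w ξ = UL) ∧
    (∀ ξ, r₁ < ξ → ξ < s → w ξ = ML) ∧
    (w s = ML ∨ w s = MR) ∧
    (∀ ξ, s < ξ → ξ < l₃ → w ξ = MR) ∧
    (∀ ξ, r₃ < ξ → w ξ = UR)

/-- Solution with vacuum (the zero state) for `C₃(UL) ≤ x / t ≤ C₁(UR)`, bordered by a complete
1-rarefaction and a complete 3-rarefaction. -/
def IsVacuumSolution (γ : ℝ) (n : EuclideanSpace ℝ (Fin d)) (UL UR : State d)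
    (w : ℝ → State d) : Prop :=
  charVar3 γ n UL ≤ charVar1 γ n UR ∧
    (∀ ξ, ξ < speed1 γ n UL → w ξ = UL) ∧
    (∀ ξ, speed1 γ n UL ≤ ξ → ξ < charVar3 γ n UL → OnFan1 γ n UL ξ (w ξ)) ∧
    (∀ ξ, charVar3 γ n UL ≤ ξ → ξ ≤ charVar1 γ n UR → w ξ = 0) ∧
    (∀ ξ, charVar1 γ n UR < ξ → ξ ≤ speed3 γ n UR → OnFan3 γ n UR ξ (w ξ)) ∧
    (∀ ξ, speed3 γ n UR < ξ → w ξ = UR)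

/-- `(x, t) ↦ w (x / t)` is the Lax solution of the Riemann problem for the γ-law. -/
def IsLaxRiemannSolution (γ : ℝ) (n : EuclideanSpace ℝ (Fin d)) (UL UR : State d)
    (w : ℝ → State d) : Prop :=
  IsThreeWaveSolution γ n UL UR w ∨ IsVacuumSolution γ n UL UR w

/-! ### Post-processing by characteristic variables -/

/-- The subsonic post-processed state: `C₃` is taken from `U`, `C₁` from `UD`, while the entropy
`S` and the tangential velocity `W` come from the inner or from the outer state. -/
def subsonicState (γ : ℝ) (n : EuclideanSpace ℝ (Fin d)) (U UD : State d) (S : ℝ)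
    (W : EuclideanSpace ℝ (Fin d)) : State d :=
  let ρP : ℝ :=
    (1 / (γ * S) * ((γ - 1) / 4 * (charVar3 γ n U - charVar1 γ n UD)) ^ 2) ^ (1 / (γ - 1))
  let VnP : ℝ := 1 / 2 * (charVar1 γ n UD + charVar3 γ n U)
  let MP : EuclideanSpace ℝ (Fin d) := ρP • (W + VnP • n)
  let PP : ℝ := S * ρP ^ γ
  (ρP, MP, 1 / (γ - 1) * PP + 1 / 2 * (‖MP‖ ^ 2 / ρP))

open Classical in
/-- Post-processing by characteristic variables: supersonic inflow, subsonic inflow,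
subsonic outflow, supersonic outflow. -/
def characteristicState (γ : ℝ) (n : EuclideanSpace ℝ (Fin d)) (U UD : State d) : State d :=
  if speed3 γ n U < 0 then UD
  else if speed2 n U < 0 then
    subsonicState γ n U UD (entropyS γ UD) (tangentialVelocity n UD)
  else if speed1 γ n U < 0 then
    subsonicState γ n U UD (entropyS γ U) (tangentialVelocity n U)
  else U

end CompressibleEuler

end

/-! For the γ-law, a state of positive density is admissible exactly when its pressure, equivalently
its entropy `S`, is positive. So it suffices to follow one of these quantities through each
construction.

In the arbitrary-law Godunov case the interface value is an essential limit of values in a compact,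
hence closed, subset of the admissible set; the filters defining it are proper because null sets
contain no interval.

For the Lax solution, rarefactions preserve `S`, and a 1-shock with `s < λ₁(U)` does not lower the
pressure (`pressure_le_of_hugoniot`). Each middle state is joined by such a wave to the data on its
own side, so the contact needs no argument. The reflection `n ↦ -n`, `ξ ↦ -ξ` turns 3-waves into
1-waves. For existence, the velocity behind a 1-wave is a continuous function of the pressure behind
it, equal to `C₃` at zero pressure and tending to `-∞`. When `C₁(UR) < C₃(UL)`, the intermediate
value theorem yields a common pressure at which the two middle velocities agree; otherwise two
complete rarefactions border a vacuum.

In the characteristic case `ρ^P` is a power of a square that vanishes only if `C₃(U) = C₁(U^D)`. The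
bound on `V_n^D` says `C₁(U^D) ≤ 0`, while in the subsonic cases `C₃(U) ≥ 0`; both vanish only in
the excluded configuration. -/

noncomputable section

namespace CompressibleEuler

variable {d : ℕ}

/-! ### Primitive variables -/

/-- The state with density `ρ`, velocity `τ + v n` and pressure `p`. -/
def stateOf (γ : ℝ) (n : EuclideanSpace ℝ (Fin d)) (ρ v p : ℝ) (τ : EuclideanSpace ℝ (Fin d)) :
    State d :=
  (ρ, ρ • (τ + v • n), p / (γ - 1) + ρ / 2 * (‖τ‖ ^ 2 + v ^ 2))

section Primitive

variable {γ ρ v p : ℝ} {n τ : EuclideanSpace ℝ (Fin d)}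

theorem norm_add_smul_sq (hn : ‖n‖ = 1) (hτ : inner ℝ τ n = 0) (v : ℝ) :
    ‖τ + v • n‖ ^ 2 = ‖τ‖ ^ 2 + v ^ 2 := by
  rw [norm_add_sq_real, inner_smul_right, hτ, norm_smul, hn]
  simp

theorem inner_add_smul (hn : ‖n‖ = 1) (hτ : inner ℝ τ n = 0) (v : ℝ) :
    inner ℝ (τ + v • n) n = v := by
  rw [inner_add_left, hτ, inner_smul_left, real_inner_self_eq_norm_sq, hn]
  simp

@[simp] theorem density_stateOf : density (stateOf γ n ρ v p τ) = ρ := rfl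

theorem velocity_stateOf (hρ : 0 < ρ) : velocity (stateOf γ n ρ v p τ) = τ + v • n := by
  simp only [velocity, density, momentum, stateOf]
  rw [smul_smul, inv_mul_cancel₀ hρ.ne', one_smul]

theorem normalVelocity_stateOf (hn : ‖n‖ = 1) (hτ : inner ℝ τ n = 0) (hρ : 0 < ρ) :
    normalVelocity n (stateOf γ n ρ v p τ) = v := by
  rw [normalVelocity, velocity_stateOf hρ, inner_add_smul hn hτ]

theorem tangentialVelocity_stateOf (hn : ‖n‖ = 1) (hτ : inner ℝ τ n = 0) (hρ : 0 < ρ) :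
    tangentialVelocity n (stateOf γ n ρ v p τ) = τ := by
  rw [tangentialVelocity, normalVelocity_stateOf hn hτ hρ, velocity_stateOf hρ, add_sub_cancel_right]

theorem gammaPressure_stateOf (hγ : 1 < γ) (hn : ‖n‖ = 1) (hτ : inner ℝ τ n = 0) (hρ : 0 < ρ) :
    gammaPressure γ (stateOf γ n ρ v p τ) = p := by
  have h := velocity_stateOf (γ := γ) (n := n) (v := v) (p := p) (τ := τ) hρ
  have hγ' : γ - 1 ≠ 0 := by linarith
  rw [velocity] at h
  rw [gammaPressure, internalEnergy, h, norm_add_smul_sq hn hτ]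
  simp only [density, totalEnergy, stateOf]
  field_simp
  ring

theorem soundSpeed_stateOf (hγ : 1 < γ) (hn : ‖n‖ = 1) (hτ : inner ℝ τ n = 0) (hρ : 0 < ρ) :
    soundSpeed γ (stateOf γ n ρ v p τ) = √(γ * p * ρ⁻¹) := by
  rw [soundSpeed, gammaPressure_stateOf hγ hn hτ hρ, density_stateOf]

theorem entropyS_stateOf (hγ : 1 < γ) (hn : ‖n‖ = 1) (hτ : inner ℝ τ n = 0) (hρ : 0 < ρ) :
    entropyS γ (stateOf γ n ρ v p τ) = ρ ^ (-γ) * p := by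
  rw [entropyS, gammaPressure_stateOf hγ hn hτ hρ, density_stateOf]

theorem inner_tangentialVelocity (hn : ‖n‖ = 1) (u : State d) :
    inner ℝ (tangentialVelocity n u) n = 0 := by
  rw [tangentialVelocity, inner_sub_left, inner_smul_left, real_inner_self_eq_norm_sq, hn,
    normalVelocity]
  simp

theorem velocity_eq (n : EuclideanSpace ℝ (Fin d)) (u : State d) :
    velocity u = tangentialVelocity n u + normalVelocity n u • n := by
  simp [tangentialVelocity]

/-- A state of positive density is determined by its primitive variables. -/
theorem eq_stateOf (hγ : 1 < γ) (hn : ‖n‖ = 1) {u : State d} (hu : 0 < density u) :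
    u = stateOf γ n (density u) (normalVelocity n u) (gammaPressure γ u)
      (tangentialVelocity n u) := by
  have hγ' : γ - 1 ≠ 0 := by linarith
  refine Prod.ext rfl (Prod.ext ?_ ?_)
  · simp only [stateOf]
    rw [← velocity_eq, velocity, smul_smul, mul_inv_cancel₀ hu.ne', one_smul, momentum]
  · simp only [stateOf]
    rw [← norm_add_smul_sq hn (inner_tangentialVelocity hn u), ← velocity_eq, gammaPressure,
      internalEnergy, velocity]
    have : u.2.2 = totalEnergy u := rfl
    rw [this]
    field_simp
    ring

theorem mem_admissible_iff (hγ : 1 < γ) {u : State d} :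
    u ∈ admissible d ↔ 0 < density u ∧ 0 < gammaPressure γ u := by
  have hγ' : 0 < γ - 1 := by linarith
  refine and_congr_right fun h => ?_
  rw [gammaPressure, mul_pos_iff_of_pos_left (mul_pos hγ' h)]

theorem entropyS_pos (hγ : 1 < γ) {u : State d} (hu : u ∈ admissible d) : 0 < entropyS γ u := by
  rw [mem_admissible_iff hγ] at hu
  exact mul_pos (Real.rpow_pos_of_pos hu.1 _) hu.2

theorem mem_admissible_of_entropyS_pos (hγ : 1 < γ) {u : State d} (hu : 0 < density u)
    (hS : 0 < entropyS γ u) : u ∈ admissible d := by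
  rw [mem_admissible_iff hγ]
  exact ⟨hu, (mul_pos_iff_of_pos_left (Real.rpow_pos_of_pos hu _)).1 hS⟩

theorem soundSpeed_pos (hγ : 1 < γ) {u : State d} (hu : u ∈ admissible d) :
    0 < soundSpeed γ u := by
  rw [mem_admissible_iff hγ] at hu
  have := hu.1
  have := hu.2
  exact Real.sqrt_pos.2 (by positivity)

theorem soundSpeed_sq (hγ : 1 < γ) {u : State d} (hu : u ∈ admissible d) :
    soundSpeed γ u ^ 2 = γ * gammaPressure γ u * (density u)⁻¹ := by
  rw [mem_admissible_iff hγ] at hu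
  have := hu.1
  have := hu.2
  exact Real.sq_sqrt (by positivity)

end Primitive

/-! ### Godunov flux for an arbitrary pressure law -/

/-- A nonempty open interval has positive measure, so it meets every conull set. This makes the
one-sided essential limits at a point meaningful. -/
theorem neBot_ae_inf_of_forall_Ioo_subset {l : Filter ℝ}
    (h : ∀ t ∈ l, ∃ a b : ℝ, a < b ∧ Set.Ioo a b ⊆ t) : (ae (volume : Measure ℝ) ⊓ l).NeBot := by
  refine inf_neBot_iff.2 fun {s} hs {t} ht => ?_
  obtain ⟨a, b, hab, hsub⟩ := h t ht
  by_contra hne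
  have hnull : volume (Set.Ioo a b) = 0 :=
    measure_mono_null (fun x hx hxs => hne ⟨x, hxs, hsub hx⟩) (mem_ae_iff.1 hs)
  rw [Real.volume_Ioo, ENNReal.ofReal_eq_zero] at hnull
  linarith

instance neBot_ae_inf_nhdsLT (x : ℝ) : (ae (volume : Measure ℝ) ⊓ 𝓝[<] x).NeBot :=
  neBot_ae_inf_of_forall_Ioo_subset fun _ ht =>
    let ⟨l, hl, hsub⟩ := mem_nhdsLT_iff_exists_Ioo_subset.1 ht
    ⟨l, x, hl, hsub⟩

instance neBot_ae_inf_nhdsGT (x : ℝ) : (ae (volume : Measure ℝ) ⊓ 𝓝[>] x).NeBot :=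
  neBot_ae_inf_of_forall_Ioo_subset fun _ ht =>
    let ⟨r, hr, hsub⟩ := mem_nhdsGT_iff_exists_Ioo_subset.1 ht
    ⟨x, r, hr, hsub⟩

theorem IsWeakRiemannSolution.interfaceValue_mem_admissible {p : State d → ℝ}
    {n : EuclideanSpace ℝ (Fin d)} {UL UR : State d} {w : ℝ → State d} {G : State d}
    (hw : IsWeakRiemannSolution p n UL UR w) (hG : IsInterfaceValue w G) : G ∈ admissible d := by
  obtain ⟨K, hK, hsub, hmem⟩ := hw.range_subset
  rcases hG with hG | hG
  · exact hsub (hK.isClosed.mem_of_tendsto hG (Filter.mem_inf_of_left hmem))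
  · exact hsub (hK.isClosed.mem_of_tendsto hG (Filter.mem_inf_of_left hmem))

/-! ### Post-processing by characteristic variables -/

/-- The kinetic energy cancels in `e`, leaving `S ρ^(γ-1) / (γ-1)`, so only positivity of the
density is at stake. -/
theorem subsonicState_mem_admissible {γ : ℝ} (hγ : 1 < γ) {n : EuclideanSpace ℝ (Fin d)}
    {U UD : State d} {S : ℝ} (hS : 0 < S) (W : EuclideanSpace ℝ (Fin d))
    (h : charVar3 γ n U ≠ charVar1 γ n UD) :
    subsonicState γ n U UD S W ∈ admissible d := by
  have hγ' : 0 < γ - 1 := by linarith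
  have hbase : 0 < 1 / (γ * S) * ((γ - 1) / 4 * (charVar3 γ n U - charVar1 γ n UD)) ^ 2 := by
    have : charVar3 γ n U - charVar1 γ n UD ≠ 0 := sub_ne_zero.2 h
    positivity
  simp only [subsonicState]
  set ρ : ℝ := (1 / (γ * S) * ((γ - 1) / 4 * (charVar3 γ n U - charVar1 γ n UD)) ^ 2) ^
    (1 / (γ - 1)) with hρ
  have hρpos : 0 < ρ := Real.rpow_pos_of_pos hbase _
  refine ⟨hρpos, ?_⟩
  simp only [internalEnergy, density, momentum, totalEnergy]
  set M := ρ • (W + (1 / 2 * (charVar1 γ n UD + charVar3 γ n U)) • n)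
  have : ρ⁻¹ * (1 / (γ - 1) * (S * ρ ^ γ) + 1 / 2 * (‖M‖ ^ 2 / ρ)) - 1 / 2 * ‖ρ⁻¹ • M‖ ^ 2
      = ρ⁻¹ * (1 / (γ - 1) * (S * ρ ^ γ)) := by
    rw [norm_smul ρ⁻¹ M, Real.norm_of_nonneg (inv_pos.2 hρpos).le]
    field_simp
    ring
  rw [this]
  positivity

theorem charVar1_nonpos {γ : ℝ} (hγ : 1 < γ) {n : EuclideanSpace ℝ (Fin d)} {u : State d}
    (h : (γ - 1) / 2 * normalVelocity n u ≤ soundSpeed γ u) : charVar1 γ n u ≤ 0 := by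
  have hγ' : 0 < γ - 1 := by linarith
  rw [charVar1, sub_nonpos, le_div_iff₀ hγ']
  linarith

theorem characteristicState_mem_admissible {γ : ℝ} (hγ : 1 < γ) (hγ3 : γ ≤ 3)
    {n : EuclideanSpace ℝ (Fin d)} {U UD : State d} (hU : U ∈ admissible d)
    (hUD : UD ∈ admissible d)
    (hD : (γ - 1) / 2 * normalVelocity n UD ≤ soundSpeed γ UD)
    (hne : ¬ (γ = 3 ∧ normalVelocity n U = -soundSpeed γ U ∧
      normalVelocity n UD = soundSpeed γ UD)) :
    characteristicState γ n U UD ∈ admissible d := by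
  have hγ' : 0 < γ - 1 := by linarith
  have ha := soundSpeed_pos hγ hU
  have hC1 := charVar1_nonpos hγ hD
  unfold characteristicState
  split_ifs with h3 h2 h1
  · exact hUD
  · refine subsonicState_mem_admissible hγ (entropyS_pos hγ hUD) _ fun heq => hne ?_
    rw [speed3, not_lt] at h3
    -- The condition `γ ≤ 3` makes this a sum of two nonnegative terms; if `C₃(U) = C₁(U^D) ≤ 0`,
    -- both must vanish, which forces the excluded case.
    have hC3 : (γ - 1) * charVar3 γ n U
        = (γ - 1) * (normalVelocity n U + soundSpeed γ U) + (3 - γ) * soundSpeed γ U := by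
      rw [charVar3]
      field_simp
      ring
    have e1 : 0 ≤ (γ - 1) * (normalVelocity n U + soundSpeed γ U) := mul_nonneg hγ'.le h3
    have e2 : 0 ≤ (3 - γ) * soundSpeed γ U := mul_nonneg (by linarith) ha.le
    have e3 : (γ - 1) * charVar3 γ n U ≤ 0 :=
      mul_nonpos_of_nonneg_of_nonpos hγ'.le (heq ▸ hC1)
    have e4 : (3 - γ) * soundSpeed γ U = 0 := by linarith
    have hγeq : γ = 3 := by
      rcases mul_eq_zero.1 e4 with h | h <;> linarith
    subst hγeq
    rw [charVar3, charVar1] at heq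
    rw [charVar3] at e3
    rw [charVar1] at hC1
    refine ⟨rfl, ?_, ?_⟩ <;> linarith
  · refine subsonicState_mem_admissible hγ (entropyS_pos hγ hU) _ fun heq => ?_
    rw [speed2, not_lt] at h2
    have : 0 < charVar3 γ n U := by
      rw [charVar3]
      positivity
    linarith
  · exact hU

/-! ### Rankine–Hugoniot condition in primitive variables -/

section Shock

variable {γ : ℝ} {n : EuclideanSpace ℝ (Fin d)}

theorem normalFlux_stateOf {ρ v p : ℝ} {τ : EuclideanSpace ℝ (Fin d)} (hγ : 1 < γ) (hn : ‖n‖ = 1)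
    (hτ : inner ℝ τ n = 0) (hρ : 0 < ρ) :
    normalFlux (gammaPressure γ) n (stateOf γ n ρ v p τ) =
      (ρ * v, v • ρ • (τ + v • n) + p • n,
        v * (p / (γ - 1) + ρ / 2 * (‖τ‖ ^ 2 + v ^ 2) + p)) := by
  rw [normalFlux, normalVelocity_stateOf hn hτ hρ, gammaPressure_stateOf hγ hn hτ hρ]
  simp only [momentum, totalEnergy, stateOf]
  rw [inner_smul_left, inner_add_smul hn hτ]
  rfl

theorem rankineHugoniot_stateOf_iff {ρ v p ρ' v' p' s : ℝ} {τ τ' : EuclideanSpace ℝ (Fin d)}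
    (hγ : 1 < γ) (hn : ‖n‖ = 1) (hτ : inner ℝ τ n = 0) (hτ' : inner ℝ τ' n = 0)
    (hρ : 0 < ρ) (hρ' : 0 < ρ') :
    RankineHugoniot γ n (stateOf γ n ρ v p τ) (stateOf γ n ρ' v' p' τ') s ↔
      ρ' * (v' - s) = ρ * (v - s) ∧
      (ρ' * (v' - s)) • τ' = (ρ * (v - s)) • τ ∧
      ρ' * (v' - s) * v' + p' = ρ * (v - s) * v + p ∧
      (p' / (γ - 1) + ρ' / 2 * (‖τ'‖ ^ 2 + v' ^ 2)) * (v' - s) + p' * v' =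
        (p / (γ - 1) + ρ / 2 * (‖τ‖ ^ 2 + v ^ 2)) * (v - s) + p * v := by
  rw [RankineHugoniot, normalFlux_stateOf hγ hn hτ hρ, normalFlux_stateOf hγ hn hτ' hρ']
  simp only [stateOf, Prod.mk_sub_mk, Prod.smul_mk, Prod.mk.injEq, smul_eq_mul]
  -- Splits the momentum jump into a part orthogonal to `n` and a multiple of `n`; the two must
  -- vanish separately.
  have key : v' • ρ' • (τ' + v' • n) + p' • n - (v • ρ • (τ + v • n) + p • n) -
      s • (ρ' • (τ' + v' • n) - ρ • (τ + v • n)) =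
      ((ρ' * (v' - s)) • τ' - (ρ * (v - s)) • τ) +
        ((ρ' * (v' - s) * v' + p') - (ρ * (v - s) * v + p)) • n := by
    module
  have hnn : inner ℝ n n = (1 : ℝ) := by rw [real_inner_self_eq_norm_sq, hn]; norm_num
  constructor
  · rintro ⟨h1, h2, h3⟩
    rw [← sub_eq_zero, key] at h2
    have h4 : (ρ' * (v' - s) * v' + p') - (ρ * (v - s) * v + p) = 0 := by
      have := congrArg (fun x => inner ℝ x n) h2
      simpa only [inner_add_left, inner_sub_left, inner_smul_left, hτ, hτ', hnn, mul_zero, mul_one,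
        sub_zero, zero_add, inner_zero_left, conj_trivial] using this
    rw [h4, zero_smul, add_zero] at h2
    exact ⟨by linarith, sub_eq_zero.1 h2, sub_eq_zero.1 h4, by linarith⟩
  · rintro ⟨h1, h2, h3, h4⟩
    refine ⟨by linarith, ?_, by linarith⟩
    rw [← sub_eq_zero, key, h2, h3]
    simp

/-- Behind a 1-shock that is supersonic relative to the state ahead, the pressure does not
decrease. -/
theorem pressure_le_of_hugoniot {ρ v p ρ' v' p' s : ℝ} (hγ : 1 < γ) (hρ : 0 < ρ)
    (hs : s < v) (hMach : γ * p < ρ * (v - s) ^ 2) {T : ℝ}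
    (hmass : ρ' * (v' - s) = ρ * (v - s))
    (hmom : ρ' * (v' - s) * v' + p' = ρ * (v - s) * v + p)
    (hen : (p' / (γ - 1) + ρ' / 2 * (T + v' ^ 2)) * (v' - s) + p' * v' =
        (p / (γ - 1) + ρ / 2 * (T + v ^ 2)) * (v - s) + p * v) : p ≤ p' := by
  have hγ' : 0 < γ - 1 := by linarith
  -- Galilean change of frame: `y` and `z` are the normal velocities relative to the shock.
  obtain ⟨y, rfl⟩ : ∃ y, v = s + y := ⟨v - s, by ring⟩
  obtain ⟨z, rfl⟩ : ∃ z, v' = s + z := ⟨v' - s, by ring⟩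
  simp only [add_sub_cancel_left] at hmass hmom hen hMach
  have hy : 0 < y := by linarith
  have hp' : p' = p + ρ * y * (y - z) := by
    rw [hmass] at hmom
    linarith
  -- Eliminating `ρ'` and `p'` leaves a quadratic in `z`: one root is the trivial solution `z = y`,
  -- the other is the genuine shock.
  have hfac : (z - y) * (2 * γ * p + (γ - 1) * (ρ * y) * y - (γ + 1) * (ρ * y) * z) = 0 := by
    field_simp at hen
    subst hp'
    linear_combination hen - (γ - 1) * (T + (s + z) ^ 2) * hmass
  have hzy : z ≤ y := by
    by_contra! hlt
    rcases mul_eq_zero.1 hfac with h | h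
    · linarith
    -- On the shock root, `γ p < ρ y²` bounds `(γ + 1) ρ y z` by `(γ + 1) ρ y²`, contradicting `y <
    -- z`.
    · have h1 : (γ + 1) * (ρ * y) * y < (γ + 1) * (ρ * y) * z := by gcongr
      nlinarith
  have : 0 ≤ ρ * y * (y - z) := mul_nonneg (by positivity) (by linarith)
  linarith

theorem RankineHugoniot.mem_admissible (hγ : 1 < γ) (hn : ‖n‖ = 1) {u v : State d} {s : ℝ}
    (h : RankineHugoniot γ n u v s) (hu : u ∈ admissible d) (hv : 0 < density v)
    (hs : s < speed1 γ n u) : v ∈ admissible d := by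
  have ha := soundSpeed_pos hγ hu
  have ha2 := soundSpeed_sq hγ hu
  rw [mem_admissible_iff hγ] at hu ⊢
  obtain ⟨hρ, hp⟩ := hu
  refine ⟨hv, hp.trans_le ?_⟩
  rw [speed1] at hs
  rw [eq_stateOf hγ hn hρ, eq_stateOf hγ hn hv, rankineHugoniot_stateOf_iff hγ hn
    (inner_tangentialVelocity hn u) (inner_tangentialVelocity hn v) hρ hv] at h
  obtain ⟨h1, h2, h3, h4⟩ := h
  have hsv : 0 < normalVelocity n u - s := by linarith
  rw [h1] at h2
  -- The mass flux through the shock is nonzero, so the tangential velocity does not jump.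
  rw [smul_right_injective _ (mul_pos hρ hsv).ne' h2] at h4
  refine pressure_le_of_hugoniot hγ hρ (by linarith) ?_ h1 h3 h4
  have : soundSpeed γ u ^ 2 < (normalVelocity n u - s) ^ 2 := by
    gcongr
    linarith
  calc γ * gammaPressure γ u = density u * soundSpeed γ u ^ 2 := by rw [ha2]; field_simp
    _ < _ := by gcongr

end Shock

/-! ### Reflection of the space variable -/

section Reflection

variable {γ : ℝ} {n : EuclideanSpace ℝ (Fin d)}

@[simp] theorem normalVelocity_neg (u : State d) :
    normalVelocity (-n) u = -normalVelocity n u := inner_neg_right _ _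

@[simp] theorem tangentialVelocity_neg (u : State d) :
    tangentialVelocity (-n) u = tangentialVelocity n u := by
  simp [tangentialVelocity]

@[simp] theorem speed1_neg (u : State d) : speed1 γ (-n) u = -speed3 γ n u := by
  simp only [speed1, speed3, normalVelocity_neg]
  ring

@[simp] theorem speed2_neg (u : State d) : speed2 (-n) u = -speed2 n u :=
  normalVelocity_neg u

@[simp] theorem charVar3_neg (u : State d) : charVar3 γ (-n) u = -charVar1 γ n u := by
  simp only [charVar1, charVar3, normalVelocity_neg]
  ring

theorem normalFlux_neg (p : State d → ℝ) (u : State d) :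
    normalFlux p (-n) u = -normalFlux p n u := by
  simp only [normalFlux, normalVelocity_neg, inner_neg_right, Prod.neg_mk, Prod.mk.injEq,
    true_and]
  exact ⟨by module, by ring⟩

theorem rankineHugoniot_neg_iff {u v : State d} {s : ℝ} :
    RankineHugoniot γ (-n) v u (-s) ↔ RankineHugoniot γ n u v s := by
  simp only [RankineHugoniot, normalFlux_neg]
  rw [show -s • (u - v) = s • (v - u) by module]
  rw [neg_sub_neg]

theorem onFan1_neg_iff {UR u : State d} {ξ : ℝ} :
    OnFan1 γ (-n) UR (-ξ) u ↔ OnFan3 γ n UR ξ u := by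
  simp only [OnFan1, OnFan3, speed1_neg, charVar3_neg, tangentialVelocity_neg, neg_inj]

/-- Every statement about 3-waves is deduced from its 1-wave counterpart through this mirror
symmetry. -/
theorem isWave1_neg_iff {w : ℝ → State d} {UM UR : State d} {l r : ℝ} :
    IsWave1 γ (-n) (fun ξ => w (-ξ)) UR UM (-r) (-l) ↔ IsWave3 γ n w UM UR l r := by
  simp only [IsWave1, IsWave3, speed1_neg, speed2_neg, onFan1_neg_iff, neg_inj, neg_neg,
    neg_lt_neg_iff, neg_le_neg_iff]
  refine or_congr ?_ ?_
  · constructor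
    · rintro ⟨rfl, h1, h2, h3, h4, h5⟩
      exact ⟨rfl, rankineHugoniot_neg_iff.1 h1, h3, h2, h4, h5.symm⟩
    · rintro ⟨rfl, h1, h2, h3, h4, h5⟩
      exact ⟨rfl, rankineHugoniot_neg_iff.2 h1, h3, h2, h4, h5.symm⟩
  · refine and_congr_right fun _ => and_congr_right fun _ => and_congr_right fun _ => ?_
    constructor
    · intro h ξ hl hr
      simpa using onFan1_neg_iff.1 (by simpa using h (-ξ) (by linarith) (by linarith))
    · intro h ξ hl hr
      have := onFan1_neg_iff.2 (h (-ξ) (by linarith) (by linarith))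
      simpa using this

end Reflection

/-! ### Admissibility of the Lax solution -/

section Admissibility

variable {γ : ℝ} {n : EuclideanSpace ℝ (Fin d)}

theorem OnFan1.mem_admissible (hγ : 1 < γ) {UL u : State d} {ξ : ℝ} (h : OnFan1 γ n UL ξ u)
    (hUL : UL ∈ admissible d) : u ∈ admissible d :=
  mem_admissible_of_entropyS_pos hγ h.1 (h.2.2.2.1 ▸ entropyS_pos hγ hUL)

theorem OnFan3.mem_admissible (hγ : 1 < γ) {UR u : State d} {ξ : ℝ} (h : OnFan3 γ n UR ξ u)
    (hUR : UR ∈ admissible d) : u ∈ admissible d :=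
  (onFan1_neg_iff.2 h).mem_admissible hγ hUR

theorem IsWave1.mem_admissible (hγ : 1 < γ) (hn : ‖n‖ = 1) {w : ℝ → State d} {UL UM : State d}
    {l r : ℝ} (h : IsWave1 γ n w UL UM l r) (hUL : UL ∈ admissible d) (hUM : 0 < density UM) :
    UM ∈ admissible d ∧ ∀ ξ, l ≤ ξ → ξ ≤ r → w ξ ∈ admissible d := by
  rcases h with ⟨rfl, hRH, -, hs, -, hw⟩ | ⟨-, -, hM, hfan⟩
  · have hM := hRH.mem_admissible hγ hn hUL hUM hs
    refine ⟨hM, fun ξ h1 h2 => ?_⟩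
    rw [← le_antisymm h1 h2]
    rcases hw with hw | hw <;> rwa [hw]
  · exact ⟨hM.mem_admissible hγ hUL, fun ξ h1 h2 => (hfan ξ h1 h2).mem_admissible hγ hUL⟩

theorem IsWave3.mem_admissible (hγ : 1 < γ) (hn : ‖n‖ = 1) {w : ℝ → State d} {UM UR : State d}
    {l r : ℝ} (h : IsWave3 γ n w UM UR l r) (hUR : UR ∈ admissible d) (hUM : 0 < density UM) :
    UM ∈ admissible d ∧ ∀ ξ, l ≤ ξ → ξ ≤ r → w ξ ∈ admissible d := by
  have := (isWave1_neg_iff.2 h).mem_admissible hγ (by rwa [norm_neg]) hUR hUM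
  refine ⟨this.1, fun ξ h1 h2 => ?_⟩
  simpa using this.2 (-ξ) (by linarith) (by linarith)

theorem IsThreeWaveSolution.mem_admissible (hγ : 1 < γ) (hn : ‖n‖ = 1) {UL UR : State d}
    {w : ℝ → State d} (h : IsThreeWaveSolution γ n UL UR w) (hUL : UL ∈ admissible d)
    (hUR : UR ∈ admissible d) (ξ : ℝ) : w ξ ∈ admissible d := by
  obtain ⟨ML, MR, l₁, r₁, s, l₃, r₃, hML, hMR, h1, -, -, -, h3, hL, hML', hs, hMR', hR⟩ := h
  obtain ⟨aML, a1⟩ := h1.mem_admissible hγ hn hUL hML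
  obtain ⟨aMR, a3⟩ := h3.mem_admissible hγ hn hUR hMR
  rcases lt_or_ge ξ l₁ with h | hl₁
  · rwa [hL ξ h]
  rcases le_or_gt ξ r₁ with h | hr₁
  · exact a1 ξ hl₁ h
  rcases lt_trichotomy ξ s with h | rfl | hξs
  · rwa [hML' ξ hr₁ h]
  · rcases hs with hs | hs <;> rwa [hs]
  rcases lt_or_ge ξ l₃ with h | hl₃
  · rwa [hMR' ξ hξs h]
  rcases le_or_gt ξ r₃ with h | hr₃
  · exact a3 ξ hl₃ h
  · rwa [hR ξ hr₃]

theorem IsVacuumSolution.mem_admissible (hγ : 1 < γ) {UL UR : State d}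
    {w : ℝ → State d} (h : IsVacuumSolution γ n UL UR w) (hUL : UL ∈ admissible d)
    (hUR : UR ∈ admissible d) {ξ : ℝ} (hξ : ¬ (charVar3 γ n UL ≤ ξ ∧ ξ ≤ charVar1 γ n UR)) :
    w ξ ∈ admissible d := by
  obtain ⟨-, hL, h1, -, h3, hR⟩ := h
  rcases lt_or_ge ξ (charVar3 γ n UL) with hlt | hge
  · rcases lt_or_ge ξ (speed1 γ n UL) with h | h
    · rwa [hL ξ h]
    · exact (h1 ξ h hlt).mem_admissible hγ hUL
  · have hgt : charVar1 γ n UR < ξ := not_le.1 fun h => hξ ⟨hge, h⟩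
    rcases le_or_gt ξ (speed3 γ n UR) with h | h
    · exact (h3 ξ hgt h).mem_admissible hγ hUR
    · rwa [hR ξ h]

end Admissibility

/-! ### Waves of prescribed pressure -/

section Waves

variable {γ : ℝ} {n : EuclideanSpace ℝ (Fin d)}

/-- The normal flux of mass through a 1-shock issued from `U` with pressure `p` behind it. -/
def shockMassFlux (γ : ℝ) (U : State d) (p : ℝ) : ℝ :=
  √(density U * (((γ + 1) * p + (γ - 1) * gammaPressure γ U) / 2))

/-- The sound speed at pressure `p` on the isentrope through `U`. -/
def isentropicSoundSpeed (γ : ℝ) (U : State d) (p : ℝ) : ℝ :=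
  √(γ * entropyS γ U ^ (1 / γ) * p ^ (1 - 1 / γ))

/-- The normal velocity behind a 1-wave issued from `U` with pressure `p` behind it. -/
def waveVelocity (γ : ℝ) (n : EuclideanSpace ℝ (Fin d)) (U : State d) (p : ℝ) : ℝ :=
  if p ≤ gammaPressure γ U then charVar3 γ n U - 2 * isentropicSoundSpeed γ U p / (γ - 1)
  else normalVelocity n U - (p - gammaPressure γ U) / shockMassFlux γ U p

/-- Since `S^(1/γ) = p^(1/γ) / ρ`, the isentropic sound speed at the pressure of `U` is that of `U`.
Hence both branches of `waveVelocity` equal `V_n` where they meet. -/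
theorem entropyS_rpow_mul (hγ : 1 < γ) {U : State d} (hU : U ∈ admissible d) :
    entropyS γ U ^ (1 / γ) * gammaPressure γ U ^ (1 - 1 / γ) =
      gammaPressure γ U * (density U)⁻¹ := by
  rw [mem_admissible_iff hγ] at hU
  obtain ⟨hρ, hp⟩ := hU
  have hγ0 : γ ≠ 0 := by linarith
  rw [entropyS, Real.mul_rpow (Real.rpow_nonneg hρ.le _) hp.le, ← Real.rpow_mul hρ.le, mul_assoc,
    ← Real.rpow_add hp, show -γ * (1 / γ) = -1 by field_simp, Real.rpow_neg_one,
    add_sub_cancel, Real.rpow_one, mul_comm]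

theorem isentropicSoundSpeed_gammaPressure (hγ : 1 < γ) {U : State d} (hU : U ∈ admissible d) :
    isentropicSoundSpeed γ U (gammaPressure γ U) = soundSpeed γ U := by
  rw [isentropicSoundSpeed, mul_assoc, entropyS_rpow_mul hγ hU, soundSpeed, mul_assoc]

theorem isentropicSoundSpeed_zero (hγ : 1 < γ) (U : State d) :
    isentropicSoundSpeed γ U 0 = 0 := by
  have : 1 / γ < 1 := by rw [div_lt_one] <;> linarith
  rw [isentropicSoundSpeed, Real.zero_rpow (by linarith)]
  simp

theorem waveVelocity_zero (hγ : 1 < γ) {U : State d} (hU : U ∈ admissible d) :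
    waveVelocity γ n U 0 = charVar3 γ n U := by
  rw [waveVelocity, if_pos ((mem_admissible_iff hγ).1 hU).2.le, isentropicSoundSpeed_zero hγ]
  simp

theorem continuous_isentropicSoundSpeed (hγ : 1 < γ) (U : State d) :
    Continuous (isentropicSoundSpeed γ U) := by
  have : 1 / γ < 1 := by rw [div_lt_one] <;> linarith
  unfold isentropicSoundSpeed
  have h : Continuous fun p : ℝ => p ^ (1 - 1 / γ) :=
    Real.continuous_rpow_const (by linarith)
  fun_prop

theorem shockMassFlux_pos (hγ : 1 < γ) {U : State d} (hU : U ∈ admissible d) {p : ℝ}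
    (hp : gammaPressure γ U ≤ p) : 0 < shockMassFlux γ U p := by
  rw [mem_admissible_iff hγ] at hU
  obtain ⟨hρ, hp0⟩ := hU
  refine Real.sqrt_pos.2 (mul_pos hρ (half_pos (add_pos ?_ ?_))) <;>
    apply mul_pos <;> linarith

theorem continuous_waveVelocity (hγ : 1 < γ) {U : State d} (hU : U ∈ admissible d) :
    Continuous (waveVelocity γ n U) := by
  refine continuous_if_le continuous_id continuous_const ?_ ?_ ?_
  · have := continuous_isentropicSoundSpeed hγ U
    fun_prop
  · refine ContinuousOn.sub continuousOn_const (ContinuousOn.div (by fun_prop) ?_ ?_)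
    · unfold shockMassFlux
      fun_prop
    · exact fun p hp => (shockMassFlux_pos hγ hU hp).ne'
  · intro p hp
    rw [show p = _ from hp, isentropicSoundSpeed_gammaPressure hγ hU, charVar3]
    simp

/-- The shock mass flux grows only like `√p`, so the velocity drop `(p - p(U)) / j` grows at least
like `√p`. -/
theorem tendsto_waveVelocity_atTop (hγ : 1 < γ) {U : State d} (hU : U ∈ admissible d) :
    Tendsto (waveVelocity γ n U) atTop atBot := by
  obtain ⟨hρ, hp0⟩ := (mem_admissible_iff hγ).1 hU
  have hρ' : 0 < √(density U * γ) := Real.sqrt_pos.2 (mul_pos hρ (by linarith))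
  have hlim : Tendsto (fun p : ℝ => normalVelocity n U + -(√p / (2 * √(density U * γ))))
      atTop atBot :=
    tendsto_atBot_add_const_left _ _ (tendsto_neg_atTop_atBot.comp
      (Real.tendsto_sqrt_atTop.atTop_div_const (by positivity)))
  refine tendsto_atBot_mono' _ ?_ hlim
  -- Beyond twice the pressure of `U`, `p - p(U) ≥ p / 2` and `j ≤ √(ρ γ p)`.
  filter_upwards [eventually_gt_atTop (2 * gammaPressure γ U)] with p hp
  have hpos : 0 < p := by linarith
  rw [waveVelocity, if_neg (by linarith), sub_eq_add_neg]
  refine add_le_add_right (neg_le_neg ?_) _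
  have hj := shockMassFlux_pos hγ hU (p := p) (by linarith)
  have hle : shockMassFlux γ U p ≤ √(density U * γ) * √p := by
    rw [← Real.sqrt_mul (by positivity), mul_assoc]
    refine Real.sqrt_le_sqrt (mul_le_mul_of_nonneg_left ?_ hρ.le)
    nlinarith
  rw [div_le_div_iff₀ (by positivity) hj]
  calc √p * shockMassFlux γ U p ≤ √p * (√(density U * γ) * √p) := by gcongr
    _ = p * √(density U * γ) := by
      linear_combination √(density U * γ) * Real.mul_self_sqrt hpos.le
    _ ≤ (p - gammaPressure γ U) * (2 * √(density U * γ)) := by nlinarith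

end Waves

/-! ### Construction of 1-waves with prescribed pressure -/

section WaveExistence

variable {γ : ℝ} {n : EuclideanSpace ℝ (Fin d)}

theorem speed1_lt_charVar3 (hγ : 1 < γ) {U : State d} (hU : U ∈ admissible d) :
    speed1 γ n U < charVar3 γ n U := by
  have ha := soundSpeed_pos hγ hU
  have : 0 < 2 * soundSpeed γ U / (γ - 1) := div_pos (by linarith) (by linarith)
  rw [speed1, charVar3]
  linarith

/-- The 1-rarefaction curve reaches every speed up to the vacuum limit `C₃`. -/
theorem exists_onFan1 (hγ : 1 < γ) (hn : ‖n‖ = 1) {U : State d} (hU : U ∈ admissible d) {ξ : ℝ}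
    (hξ : ξ < charVar3 γ n U) : ∃ u, OnFan1 γ n U ξ u := by
  have hγ' : 0 < γ - 1 := by linarith
  have hS := entropyS_pos hγ hU
  -- Solves `v - a = ξ` and `v + 2a / (γ - 1) = C₃` for the sound speed; the density then comes from
  -- `a² = γ S ρ^(γ-1)`.
  obtain ⟨a, ha⟩ : ∃ a, a = (γ - 1) / (γ + 1) * (charVar3 γ n U - ξ) := ⟨_, rfl⟩
  have ha0 : 0 < a := by
    rw [ha]
    exact mul_pos (by positivity) (by linarith)
  have hb : 0 < a ^ 2 / (γ * entropyS γ U) := by positivity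
  obtain ⟨ρ, hρ⟩ : ∃ ρ, ρ = (a ^ 2 / (γ * entropyS γ U)) ^ (1 / (γ - 1)) := ⟨_, rfl⟩
  have hρ0 : 0 < ρ := hρ ▸ Real.rpow_pos_of_pos hb _
  have hργ : ρ ^ (γ - 1) = a ^ 2 / (γ * entropyS γ U) := by
    rw [hρ, ← Real.rpow_mul hb.le, one_div_mul_cancel hγ'.ne', Real.rpow_one]
  have hτ := inner_tangentialVelocity hn U
  have hc : soundSpeed γ (stateOf γ n ρ (ξ + a) (a ^ 2 * ρ / γ) (tangentialVelocity n U)) = a := by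
    rw [soundSpeed_stateOf hγ hn hτ hρ0, show γ * (a ^ 2 * ρ / γ) * ρ⁻¹ = a ^ 2 by field_simp,
      Real.sqrt_sq ha0.le]
  refine ⟨stateOf γ n ρ (ξ + a) (a ^ 2 * ρ / γ) (tangentialVelocity n U), hρ0, ?_, ?_, ?_,
    tangentialVelocity_stateOf hn hτ hρ0⟩
  · rw [speed1, hc, normalVelocity_stateOf hn hτ hρ0, add_sub_cancel_right]
  · rw [charVar3, hc, normalVelocity_stateOf hn hτ hρ0, ha]
    field_simp
    ring
  · rw [entropyS_stateOf hγ hn hτ hρ0, show -γ = -(γ - 1) - 1 by ring, Real.rpow_sub hρ0,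
      Real.rpow_neg hρ0.le, hργ, Real.rpow_one]
    field_simp

theorem exists_onFan3 (hγ : 1 < γ) (hn : ‖n‖ = 1) {U : State d} (hU : U ∈ admissible d) {ξ : ℝ}
    (hξ : charVar1 γ n U < ξ) : ∃ u, OnFan3 γ n U ξ u := by
  obtain ⟨u, hu⟩ := exists_onFan1 hγ (n := -n) (by rwa [norm_neg]) hU (ξ := -ξ)
    (by rw [charVar3_neg]; linarith)
  exact ⟨u, onFan1_neg_iff.1 hu⟩

/-- A 1-wave issued from `U` with pressure `p` behind it; the profile inside the wave is `f`. -/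
structure Wave1Data (γ : ℝ) (n : EuclideanSpace ℝ (Fin d)) (U : State d) (p : ℝ) (UM : State d)
    (l r : ℝ) (f : ℝ → State d) : Prop where
  density_pos : 0 < density UM
  normalVelocity_eq : normalVelocity n UM = waveVelocity γ n U p
  gammaPressure_eq : gammaPressure γ UM = p
  le : l ≤ r
  lt : r < waveVelocity γ n U p
  isWave1 : ∀ w : ℝ → State d, (∀ ξ, l ≤ ξ → ξ ≤ r → w ξ = f ξ) → IsWave1 γ n w U UM l r

/-- The state behind lies on the isentrope of `U`, so `p = S ρ^γ` fixes its density and `C₃` its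
normal velocity. -/
theorem exists_rarefaction1 (hγ : 1 < γ) (hn : ‖n‖ = 1) {U : State d} (hU : U ∈ admissible d)
    {p : ℝ} (hp : 0 < p) (hpU : p ≤ gammaPressure γ U) :
    ∃ UM l r f, Wave1Data γ n U p UM l r f := by
  have hγ' : 0 < γ - 1 := by linarith
  have hγ0 : γ ≠ 0 := by linarith
  have hS := entropyS_pos hγ hU
  have hpS : 0 < p / entropyS γ U := by positivity
  obtain ⟨ρ, hρ⟩ : ∃ ρ, ρ = (p / entropyS γ U) ^ (1 / γ) := ⟨_, rfl⟩
  have hρ0 : 0 < ρ := hρ ▸ Real.rpow_pos_of_pos hpS _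
  have hτ := inner_tangentialVelocity hn U
  have hv : waveVelocity γ n U p =
      charVar3 γ n U - 2 * isentropicSoundSpeed γ U p / (γ - 1) := if_pos hpU
  obtain ⟨UM, hUM⟩ : ∃ UM, UM = stateOf γ n ρ (waveVelocity γ n U p) p (tangentialVelocity n U) :=
    ⟨_, rfl⟩
  have hMv : normalVelocity n UM = waveVelocity γ n U p := by
    rw [hUM, normalVelocity_stateOf hn hτ hρ0]
  have hMp : gammaPressure γ UM = p := by rw [hUM, gammaPressure_stateOf hγ hn hτ hρ0]
  have hMd : density UM = ρ := by rw [hUM, density_stateOf]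
  have hMa : soundSpeed γ UM = isentropicSoundSpeed γ U p := by
    rw [hUM, soundSpeed_stateOf hγ hn hτ hρ0, isentropicSoundSpeed, hρ,
      Real.div_rpow hp.le hS.le, Real.rpow_sub hp, Real.rpow_one]
    congr 1
    field_simp
  have hMS : entropyS γ UM = entropyS γ U := by
    rw [hUM, entropyS_stateOf hγ hn hτ hρ0, hρ, ← Real.rpow_mul hpS.le,
      show 1 / γ * -γ = -1 by field_simp, Real.rpow_neg_one]
    field_simp
  have hMC : charVar3 γ n UM = charVar3 γ n U := by
    rw [charVar3, hMv, hMa, hv]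
    ring
  have hadm : UM ∈ admissible d := mem_admissible_of_entropyS_pos hγ (hMd ▸ hρ0) (hMS ▸ hS)
  have haM := soundSpeed_pos hγ hadm
  have hle : soundSpeed γ UM ≤ soundSpeed γ U := by
    have h1 : 1 / γ ≤ 1 := by rw [div_le_one] <;> linarith
    rw [hMa, ← isentropicSoundSpeed_gammaPressure hγ hU, isentropicSoundSpeed,
      isentropicSoundSpeed]
    refine Real.sqrt_le_sqrt (mul_le_mul_of_nonneg_left
      (Real.rpow_le_rpow hp.le hpU (by linarith)) (by positivity))
  choose! f hf using fun ξ (hξ : ξ < charVar3 γ n U) => exists_onFan1 hγ hn hU hξ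
  refine ⟨UM, speed1 γ n U, speed1 γ n UM, f, hMd ▸ hρ0, hMv, hMp, ?_, ?_, fun w hw => Or.inr
    ⟨rfl, ?_, ⟨hMd ▸ hρ0, rfl, hMC, hMS, ?_⟩, fun ξ h1 h2 => ?_⟩⟩
  case refine_4 => rw [hUM, tangentialVelocity_stateOf hn hτ hρ0]
  case refine_2 => rw [speed1, hMv]; linarith
  case refine_5 =>
    rw [hw ξ h1 h2]
    exact hf ξ (h2.trans_lt (hMC ▸ speed1_lt_charVar3 hγ hadm))
  -- Both remaining goals say that the fan opens: with `C₃` shared, a smaller sound speed means a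
  -- larger `λ₁`.
  all_goals
    have h3 : 2 * soundSpeed γ UM / (γ - 1) ≤ 2 * soundSpeed γ U / (γ - 1) := by gcongr
    rw [charVar3, charVar3] at hMC
    rw [speed1, speed1]
    linarith

theorem exists_shock1 (hγ : 1 < γ) (hn : ‖n‖ = 1) {U : State d} (hU : U ∈ admissible d)
    {p : ℝ} (hpU : gammaPressure γ U < p) :
    ∃ UM l r f, Wave1Data γ n U p UM l r f := by
  have hγ' : 0 < γ - 1 := by linarith
  obtain ⟨hρ, hp0⟩ := (mem_admissible_iff hγ).1 hU
  have hj := shockMassFlux_pos hγ hU hpU.le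
  have ha2 := soundSpeed_sq hγ hU
  have hτ := inner_tangentialVelocity hn U
  have hv : waveVelocity γ n U p = normalVelocity n U -
    (p - gammaPressure γ U) / shockMassFlux γ U p := if_neg hpU.not_ge
  have hj2 : shockMassFlux γ U p ^ 2 =
      density U * (((γ + 1) * p + (γ - 1) * gammaPressure γ U) / 2) := by
    refine Real.sq_sqrt ?_
    have : 0 < p := hp0.trans hpU
    positivity
  have heq := eq_stateOf hγ hn hρ
  obtain ⟨T, hT⟩ : ∃ T, T = tangentialVelocity n U := ⟨_, rfl⟩
  rw [← hT] at hτ heq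
  obtain ⟨p₀, hp₀⟩ : ∃ p₀, p₀ = gammaPressure γ U := ⟨_, rfl⟩
  obtain ⟨ρ, hρe⟩ : ∃ ρ, ρ = density U := ⟨_, rfl⟩
  obtain ⟨v, hve⟩ : ∃ v, v = normalVelocity n U := ⟨_, rfl⟩
  obtain ⟨j, hje⟩ : ∃ j, j = shockMassFlux γ U p := ⟨_, rfl⟩
  rw [← hp₀, ← hρe, ← hve] at heq
  rw [← hρe, ← hp₀] at ha2
  rw [← hje, ← hρe, ← hp₀] at hj2
  rw [← hve, ← hp₀, ← hje] at hv
  rw [← hp₀] at hp0 hpU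
  rw [← hρe] at hρ
  rw [← hje] at hj
  have hp : 0 < p := hp0.trans hpU
  -- With `j² = ρ X / 2`, the velocities relative to the shock are `j / ρ = X / (2j)` ahead and `Y /
  -- (2j)` behind, so mass conservation gives the density `ρ X / Y` behind.
  obtain ⟨X, hX⟩ : ∃ X, X = (γ + 1) * p + (γ - 1) * p₀ := ⟨_, rfl⟩
  obtain ⟨Y, hY⟩ : ∃ Y, Y = (γ - 1) * p + (γ + 1) * p₀ := ⟨_, rfl⟩
  have hX0 : 0 < X := by rw [hX]; positivity
  have hY0 : 0 < Y := by rw [hY]; positivity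
  rw [← hX] at hj2
  have hM0 : 0 < ρ * X / Y := by positivity
  -- normal velocities relative to the shock
  obtain ⟨s, hs⟩ : ∃ s, s = v - X / (2 * j) := ⟨_, rfl⟩
  have hys : v - s = X / (2 * j) := by rw [hs]; ring
  have hzs : waveVelocity γ n U p - s = Y / (2 * j) := by
    rw [hv, hs, hX, hY]
    field_simp
    ring
  have hmass : ρ * (X / (2 * j)) = j := by
    field_simp
    linear_combination -2 * hj2
  have hmass' : ρ * X / Y * (Y / (2 * j)) = j := by
    field_simp
    linear_combination -2 * hj2
  have haU := soundSpeed_pos hγ hU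
  have hz0 : 0 < Y / (2 * j) := by positivity
  obtain ⟨UM, hUM⟩ : ∃ UM, UM = stateOf γ n (ρ * X / Y) (waveVelocity γ n U p) p T :=
    ⟨_, rfl⟩
  have hMv : normalVelocity n UM = waveVelocity γ n U p := by
    rw [hUM, normalVelocity_stateOf hn hτ hM0]
  refine ⟨UM, s, s, fun _ => U, ?_, hMv, ?_, le_rfl, by linarith, fun w hw => Or.inl
    ⟨rfl, ?_, ?_, ?_, ?_, Or.inl (hw s le_rfl le_rfl)⟩⟩
  · rwa [hUM, density_stateOf]
  · rw [hUM, gammaPressure_stateOf hγ hn hτ hM0]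
  · rw [heq, hUM, rankineHugoniot_stateOf_iff hγ hn hτ hτ hρ hM0, hzs, hys, hmass, hmass']
    refine ⟨rfl, rfl, ?_, ?_⟩
    · rw [hv]
      field_simp
      ring
    · have e1 : (p / (γ - 1) + ρ * X / Y / 2 * (‖T‖ ^ 2 + waveVelocity γ n U p ^ 2)) *
          (Y / (2 * j)) = p / (γ - 1) * (Y / (2 * j)) +
            j / 2 * (‖T‖ ^ 2 + waveVelocity γ n U p ^ 2) := by
        linear_combination (‖T‖ ^ 2 + waveVelocity γ n U p ^ 2) / 2 * hmass'
      have e2 : (p₀ / (γ - 1) + ρ / 2 * (‖T‖ ^ 2 + v ^ 2)) * (X / (2 * j)) =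
          p₀ / (γ - 1) * (X / (2 * j)) + j / 2 * (‖T‖ ^ 2 + v ^ 2) := by
        linear_combination (‖T‖ ^ 2 + v ^ 2) / 2 * hmass
      rw [e1, e2, hv, hX, hY]
      field_simp
      ring
  -- Both Lax inequalities reduce to `p₀ < p`, as `2γp - Y` and `X - 2γp₀` both equal `(γ + 1)(p -
  -- p₀)`.
  · have hlt : Y / (2 * j) < soundSpeed γ UM := by
      rw [hUM, soundSpeed_stateOf hγ hn hτ hM0]
      refine Real.lt_sqrt_of_sq_lt ?_
      have : γ * p * (ρ * X / Y)⁻¹ - (Y / (2 * j)) ^ 2 =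
          Y / (2 * ρ * X) * (2 * γ * p - Y) := by
        rw [div_pow, mul_pow, hj2]
        field_simp
      have h2 : 0 < 2 * γ * p - Y := by rw [hY]; nlinarith
      have h3 : 0 < Y / (2 * ρ * X) * (2 * γ * p - Y) := by positivity
      linarith
    rw [speed1, hMv]
    linarith
  · have hlt : soundSpeed γ U < X / (2 * j) := by
      refine lt_of_pow_lt_pow_left₀ 2 (by positivity) ?_
      rw [ha2]
      have : (X / (2 * j)) ^ 2 - γ * p₀ * ρ⁻¹ = (X - 2 * γ * p₀) / (2 * ρ) := by
        rw [div_pow, mul_pow, hj2]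
        field_simp
      have h2 : 0 < X - 2 * γ * p₀ := by rw [hX]; nlinarith
      have h3 : 0 < (X - 2 * γ * p₀) / (2 * ρ) := by positivity
      linarith
    rw [speed1, ← hve]
    linarith
  · rw [speed2, hMv]
    linarith

theorem exists_wave1 (hγ : 1 < γ) (hn : ‖n‖ = 1) {U : State d} (hU : U ∈ admissible d)
    {p : ℝ} (hp : 0 < p) : ∃ UM l r f, Wave1Data γ n U p UM l r f :=
  (le_or_gt p (gammaPressure γ U)).elim (exists_rarefaction1 hγ hn hU hp) (exists_shock1 hγ hn hU)

end WaveExistence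

/-! ### Existence of the Lax solution -/

section Existence

variable {γ : ℝ} {n : EuclideanSpace ℝ (Fin d)}

theorem exists_middle_pressure (hγ : 1 < γ) {UL UR : State d} (hUL : UL ∈ admissible d)
    (hUR : UR ∈ admissible d) (h : charVar1 γ n UR < charVar3 γ n UL) :
    ∃ p, 0 < p ∧ waveVelocity γ n UL p = -waveVelocity γ (-n) UR p := by
  have h0 : 0 < waveVelocity γ n UL 0 + waveVelocity γ (-n) UR 0 := by
    rw [waveVelocity_zero hγ hUL, waveVelocity_zero hγ hUR, charVar3_neg]
    linarith
  have hlim : Tendsto (fun p => waveVelocity γ n UL p + waveVelocity γ (-n) UR p) atTop atBot :=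
    (tendsto_waveVelocity_atTop hγ hUL).atBot_add_atBot (tendsto_waveVelocity_atTop hγ hUR)
  obtain ⟨P, hP, hP0⟩ := ((hlim.eventually_le_atBot 0).and (eventually_ge_atTop 0)).exists
  have hcont : Continuous fun p => waveVelocity γ n UL p + waveVelocity γ (-n) UR p :=
    (continuous_waveVelocity hγ hUL).add (continuous_waveVelocity hγ hUR)
  obtain ⟨p, hp, hp2⟩ := intermediate_value_Icc' hP0 hcont.continuousOn ⟨hP, h0.le⟩
  simp only at hp2
  refine ⟨p, lt_of_le_of_ne hp.1 ?_, by linarith⟩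
  -- At zero pressure the sum of the velocities is `C₃(UL) - C₁(UR) > 0`, so `p = 0` is not the
  -- root.
  rintro rfl
  linarith

theorem exists_isThreeWaveSolution (hγ : 1 < γ) (hn : ‖n‖ = 1) {UL UR : State d}
    (hUL : UL ∈ admissible d) (hUR : UR ∈ admissible d)
    (h : charVar1 γ n UR < charVar3 γ n UL) : ∃ w, IsThreeWaveSolution γ n UL UR w := by
  obtain ⟨p, hp, hpv⟩ := exists_middle_pressure hγ hUL hUR h
  obtain ⟨ML, l₁, r₁, f, hL⟩ := exists_wave1 hγ hn hUL hp
  obtain ⟨MR, l, r, g, hR⟩ := exists_wave1 hγ (n := -n) (by rwa [norm_neg]) hUR hp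
  obtain ⟨s, hs⟩ : ∃ s, s = waveVelocity γ n UL p := ⟨_, rfl⟩
  have hlr := hL.le
  have hlr' := hR.le
  have hr₁ : r₁ < s := hs ▸ hL.lt
  have hr : s < -r := by linarith [hR.lt]
  have hMR : normalVelocity n MR = s := by
    have := hR.normalVelocity_eq
    rw [normalVelocity_neg] at this
    linarith
  classical
  -- The 3-wave is the mirror image of a 1-wave issued from `UR` in direction `-n`, hence the sector
  -- `[-r, -l]` and the profile `g (-ξ)`. The ordering `r₁ < s < -r` keeps the sectors disjoint.
  refine ⟨fun ξ => if ξ < l₁ then UL else if ξ ≤ r₁ then f ξ else if ξ ≤ s then ML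
    else if ξ < -r then MR else if ξ ≤ -l then g (-ξ) else UR,
    ML, MR, l₁, r₁, s, -r, -l, hL.density_pos, hR.density_pos, hL.isWave1 _ ?_,
    hs ▸ hL.normalVelocity_eq, hMR, hL.gammaPressure_eq.trans hR.gammaPressure_eq.symm,
    isWave1_neg_iff.1 ?_, ?_, ?_, Or.inl ?_, ?_, ?_⟩
  · intro ξ h1 h2
    rw [if_neg h1.not_gt, if_pos h2]
  · rw [neg_neg, neg_neg]
    refine hR.isWave1 _ fun ξ h1 h2 => ?_
    rw [if_neg (by linarith), if_neg (by linarith), if_neg (by linarith), if_neg (by linarith),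
      if_pos (by linarith), neg_neg]
  · intro ξ h1
    exact if_pos h1
  · intro ξ h1 h2
    beta_reduce
    rw [if_neg (by linarith), if_neg (by linarith), if_pos h2.le]
  · beta_reduce
    rw [if_neg (by linarith), if_neg (by linarith), if_pos le_rfl]
  · intro ξ h1 h2
    beta_reduce
    rw [if_neg (by linarith), if_neg (by linarith), if_neg (by linarith), if_pos h2]
  · intro ξ h1
    beta_reduce
    rw [if_neg (by linarith), if_neg (by linarith), if_neg (by linarith), if_neg (by linarith),
      if_neg (by linarith)]

theorem exists_isVacuumSolution (hγ : 1 < γ) (hn : ‖n‖ = 1) {UL UR : State d}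
    (hUL : UL ∈ admissible d) (hUR : UR ∈ admissible d)
    (h : charVar3 γ n UL ≤ charVar1 γ n UR) : ∃ w, IsVacuumSolution γ n UL UR w := by
  have h1 : speed1 γ n UL < charVar3 γ n UL := speed1_lt_charVar3 hγ hUL
  have h3 : charVar1 γ n UR < speed3 γ n UR := by
    have := speed1_lt_charVar3 (n := -n) hγ hUR
    rw [speed1_neg, charVar3_neg] at this
    linarith
  choose! f hf using fun ξ (hξ : ξ < charVar3 γ n UL) => exists_onFan1 hγ hn hUL hξ
  choose! g hg using fun ξ (hξ : charVar1 γ n UR < ξ) => exists_onFan3 hγ hn hUR hξ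
  classical
  refine ⟨fun ξ => if ξ < speed1 γ n UL then UL else if ξ < charVar3 γ n UL then f ξ
    else if ξ ≤ charVar1 γ n UR then 0 else if ξ ≤ speed3 γ n UR then g ξ else UR,
    h, ?_, ?_, ?_, ?_, ?_⟩
  · intro ξ hξ
    exact if_pos hξ
  · intro ξ hξ hξ'
    beta_reduce
    rw [if_neg hξ.not_gt, if_pos hξ']
    exact hf ξ hξ'
  · intro ξ hξ hξ'
    beta_reduce
    rw [if_neg (by linarith), if_neg (by linarith), if_pos hξ']
  · intro ξ hξ hξ'
    beta_reduce
    rw [if_neg (by linarith), if_neg (by linarith), if_neg (by linarith), if_pos hξ']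
    exact hg ξ hξ
  · intro ξ hξ
    beta_reduce
    rw [if_neg (by linarith), if_neg (by linarith), if_neg (by linarith), if_neg (by linarith)]

theorem exists_isLaxRiemannSolution (hγ : 1 < γ) (hn : ‖n‖ = 1) {UL UR : State d}
    (hUL : UL ∈ admissible d) (hUR : UR ∈ admissible d) :
    ∃ w, IsLaxRiemannSolution γ n UL UR w := by
  rcases lt_or_ge (charVar1 γ n UR) (charVar3 γ n UL) with h | h
  · exact (exists_isThreeWaveSolution hγ hn hUL hUR h).imp fun _ => Or.inl
  · exact (exists_isVacuumSolution hγ hn hUL hUR h).imp fun _ => Or.inr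

end Existence

end CompressibleEuler

end

open CompressibleEuler in
theorem lemma4p2 {d : ℕ} (n : EuclideanSpace ℝ (Fin d)) (hn : ‖n‖ = 1) (U UD : State d)
    (hU : U ∈ admissible d) (hUD : UD ∈ admissible d) :
    -- Godunov, arbitrary pressure law
    (∀ (p : State d → ℝ) (w : ℝ → State d) (G : State d),
      IsWeakRiemannSolution p n U UD w → IsInterfaceValue w G → G ∈ admissible d) ∧
    -- Godunov, γ-law, vacuum not excluded in the solution but absent at `x = 0`
    (∀ γ : ℝ, 1 < γ →
      (∃ w : ℝ → State d, IsLaxRiemannSolution γ n U UD w) ∧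
      (¬ (charVar3 γ n U ≤ 0 ∧ 0 ≤ charVar1 γ n UD) →
        ∀ w : ℝ → State d, IsLaxRiemannSolution γ n U UD w → w 0 ∈ admissible d)) ∧
    -- characteristic variables
    (∀ γ : ℝ, 1 < γ → γ ≤ 3 →
      (γ - 1) / 2 * normalVelocity n UD ≤ soundSpeed γ UD →
      ¬ (γ = 3 ∧ normalVelocity n U = -soundSpeed γ U ∧
        normalVelocity n UD = soundSpeed γ UD) →
      characteristicState γ n U UD ∈ admissible d) := by
  refine ⟨fun p w G hw hG => hw.interfaceValue_mem_admissible hG, fun γ hγ =>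
    ⟨exists_isLaxRiemannSolution hγ hn hU hUD, fun hvac w hw => ?_⟩,
    fun γ hγ hγ3 hD hne => characteristicState_mem_admissible hγ hγ3 hU hUD hD hne⟩
  rcases hw with hw | hw
  · exact hw.mem_admissible hγ hn hU hUD 0
  · exact hw.mem_admissible hγ hU hUD hvac
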